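/- Let $K$ be the number of subcarriers and, for each $k\in\{1,\dots,K\}$, let $m_k\ge 1$ be the number of spatial dimensions open to the transmitter on subcarrier $k$ and $n_k$ the number of receive dimensions. Let $(\widetilde{\mathbf H}_k(t))_{t\ge 1}$ be arbitrary uniformly bounded sequences of complex $n_k\times m_k$ matrices (the effective channel matrices). For positive semidefinite $\mathbf P_k\in\mathbb C^{m_k\times m_k}$ put $$\Phi(\mathbf P;t)=\sum_{k=1}^K\log\det\big[\mathbf I+\widetilde{\mathbf H}_k(t)\mathbf P_k\widetilde{\mathbf H}_k^\dagger(t)\big],\qquad \mathbf M_k(\mathbf P;t)=\widetilde{\mathbf H}_k^\dagger(t)\big[\mathbf I+\widetilde{\mathbf H}_k(t)\mathbf P_k\widetilde{\mathbf H}_k^\dagger(t)\big]^{-1}\widetilde{\mathbf H}_k(t).$$ Given a total power $P$ and caps $P_k$, let $\mathcal X$ be the set of profiles $\mathbf P=\mathrm{diag}(\mathbf P_1,\dots,\mathbf P_K)$ with $\mathbf P_k\succcurlyeq 0$, $\mathrm{tr}(\mathbf P_k)\le P_k$ and $\sum_k\mathrm{tr}(\mathbf P_k)=P$. Let $\mathcal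 D_k=\{\mathbf Q_k\in\mathbb C^{m_k\times m_k}:\mathbf Q_k\succcurlyeq 0,\ \mathrm{tr}(\mathbf Q_k)=1\}$ and $\mathcal X_+=\prod_k\mathcal D_k$. Fix a power allocation $p=(p_1,\dots,p_K)$ with $0\le p_k\le P_k$ and $\sum_kp_k=P$, write $p\mathbf Q=\mathrm{diag}(p_1\mathbf Q_1,\dots,p_K\mathbf Q_K)$, and fix $\eta>0$. The matrix exponential learning policy (XL-COV) is defined by $\mathbf Y_k(0)=0$, $\mathbf Q_k(1)=\mathbf I/m_k$ and, for $t=1,2,\dots$, $$\mathbf Y_k(t)=\mathbf Y_k(t-1)+p_k\,\mathbf M_k(p\mathbf Q(t);t),\qquad \mathbf Q_k(t+1)=\frac{\exp\big(\eta t^{-1/2}\mathbf Y_k(t)\big)}{\mathrm{tr}\big[\exp\big(\eta t^{-1/2}\mathbf Y_k(t)\big)\big]}.$$ For $\mathbf Q_0\in\mathcal X_+$ let $\mathrm{Reg}_T(\mathbf Q_0)=\sum_{t=1}^T\big[\Phi(p\mathbf Q_0;t)-\Phi(p\mathbf Q(t);t)\big]$. Then $\mathbf Q(t)\in\mathcal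 X_+$ for all $t\ge1$, and the policy leads to no regret: $\limsup_{T\to\infty}\frac1T\mathrm{Reg}_T(\mathbf Q_0)\le 0$ for every $\mathbf Q_0\in\mathcal X_+$. Moreover, if $M$ is any constant with $\|\mathbf M_k(\mathbf P;t)\|\le M$ (spectral norm) for all $k$, all $\mathbf P\in\mathcal X$ and all $t\ge1$, then for every $\mathbf Q_0\in\mathcal X_+$ and every $T\ge 1$ $$\frac1T\mathrm{Reg}_T(\mathbf Q_0)\le\frac1{\sqrt T}\left(\frac{\sum_{k=1}^K\log m_k}{\eta}+4P^2M^2\eta\right).$$ -/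

import Mathlib

open scoped Matrix ComplexOrder

namespace OnlineMIMO

/-- A profile of square complex matrices, one `m k × m k` block for each subcarrier `k`
(the blocks of a block-diagonal matrix `diag(P₁, …, P_K)`). -/
abbrev Profile {K : ℕ} (m : Fin K → ℕ) : Type :=
  ∀ k : Fin K, Matrix (Fin (m k)) (Fin (m k)) ℂ

/-- A stream of effective channel matrices: `H t k` is the `n k × m k` effective channel matrix
of subcarrier `k` at stage `t` (only the stages `t = 1, 2, …` are used). -/
abbrev ChannelStream {K : ℕ} (n m : Fin K → ℕ) : Type :=
  ℕ → ∀ k : Fin K, Matrix (Fin (n k)) (Fin (m k)) ℂ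

/-- The spectral norm: the operator norm induced by the Euclidean norms. -/
noncomputable def specNorm {a b : ℕ} (A : Matrix (Fin a) (Fin b) ℂ) : ℝ :=
  ‖(Matrix.toEuclideanLin A).toContinuousLinearMap‖

/-- Power allocation vectors: `0 ≤ p k ≤ Pmax k` and total power `Ptot`. -/
def powerSet {K : ℕ} (Pmax : Fin K → ℝ) (Ptot : ℝ) : Set (Fin K → ℝ) :=
  {p | (∀ k, 0 ≤ p k ∧ p k ≤ Pmax k) ∧ ∑ k, p k = Ptot}

/-- Admissible transmit profiles: positive semidefinite blocks, trace of block `k` at most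
`Pmax k`, total trace `Ptot`. -/
def transmitSet {K : ℕ} (m : Fin K → ℕ) (Pmax : Fin K → ℝ) (Ptot : ℝ) : Set (Profile m) :=
  {P | (∀ k, (P k).PosSemidef ∧ (P k).trace.re ≤ Pmax k) ∧ ∑ k, (P k).trace.re = Ptot}

/-- The product of spectrahedra: normalized covariance profiles, with positive semidefinite
blocks of trace one. -/
def covSet {K : ℕ} (m : Fin K → ℕ) : Set (Profile m) :=
  {Q | ∀ k, (Q k).PosSemidef ∧ (Q k).trace = 1}

/-- The transmit profile `diag(p₁ Q₁, …, p_K Q_K)`. -/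
noncomputable def withPower {K : ℕ} {m : Fin K → ℕ} (p : Fin K → ℝ) (Q : Profile m) : Profile m :=
  fun k => p k • Q k

/-- The transmission rate `∑ k, log det (I + H_k P_k H_k†)`. For positive semidefinite `P k` the
determinant is a positive real number; its real part is taken only to apply the real logarithm. -/
noncomputable def rate {K : ℕ} {n m : Fin K → ℕ}
    (H : ∀ k : Fin K, Matrix (Fin (n k)) (Fin (m k)) ℂ) (P : Profile m) : ℝ :=
  ∑ k, Real.log ((1 + H k * P k * (H k)ᴴ).det.re)

/-- The gradient matrices `H_k† (I + H_k P_k H_k†)⁻¹ H_k` of the rate function. -/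
noncomputable def rateGrad {K : ℕ} {n m : Fin K → ℕ}
    (H : ∀ k : Fin K, Matrix (Fin (n k)) (Fin (m k)) ℂ) (P : Profile m) : Profile m :=
  fun k => (H k)ᴴ * (1 + H k * P k * (H k)ᴴ)⁻¹ * H k

/-- The exponential map `Y ↦ exp (c Y) / tr (exp (c Y))`, blockwise. -/
noncomputable def expMap {K : ℕ} {m : Fin K → ℕ} (c : ℝ) (Y : Profile m) : Profile m :=
  fun k => (NormedSpace.exp (c • Y k)).trace⁻¹ • NormedSpace.exp (c • Y k)

/-- The score matrices `Y(t)` of matrix exponential learning at fixed powers `p`: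
`Y(0) = 0` and `Y_k(t+1) = Y_k(t) + p_k M_k(t+1)`, where `M_k(t+1)` is the gradient matrix at the
profile with covariances `Q(t+1) = expMap (η t^{-1/2}) (Y(t))`. At `t = 0` the scores vanish, so
`Q_k(1) = I / m_k` whatever the value of the prefactor. -/
noncomputable def xlScore {K : ℕ} {n m : Fin K → ℕ} (H : ChannelStream n m)
    (p : Fin K → ℝ) (η : ℝ) : ℕ → Profile m
  | 0 => 0
  | t + 1 => fun k =>
      xlScore H p η t k +
        p k • rateGrad (H (t + 1)) (withPower p (expMap (η / √(t : ℝ)) (xlScore H p η t))) k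

/-- The covariance profile `Q(t)` played by matrix exponential learning at stage `t ≥ 1`:
`Q(t+1) = exp (η t^{-1/2} Y(t)) / tr (exp (η t^{-1/2} Y(t)))`. -/
noncomputable def xlCov {K : ℕ} {n m : Fin K → ℕ} (H : ChannelStream n m)
    (p : Fin K → ℝ) (η : ℝ) (t : ℕ) : Profile m :=
  expMap (η / √((t - 1 : ℕ) : ℝ)) (xlScore H p η (t - 1))

/-- The cumulative regret up to stage `T`, at fixed powers `p`, of a sequence of covariance
profiles `Q` with respect to the benchmark `Q₀`. -/
noncomputable def regret {K : ℕ} {n m : Fin K → ℕ} (H : ChannelStream n m)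
    (p : Fin K → ℝ) (Q : ℕ → Profile m) (Q₀ : Profile m) (T : ℕ) : ℝ :=
  ∑ t ∈ Finset.Icc 1 T, (rate (H t) (withPower p Q₀) - rate (H t) (withPower p (Q t)))

end OnlineMIMO

/-! Concavity of `log det` bounds the regret by a sum over subcarriers of linear regrets against the
gradient matrices (`rate_sub_rate_le`), so each block can be analysed as exponential weights on its
own spectrahedron.

In one block the potential is `(logPartition (σ_t • Y_t) - log N) / σ_t`, where `σ_t` is the step
size and `N` the dimension. It starts at zero. Lowering the step size cannot raise it
(`logPartition_smul_mono`). Adding a payoff `a • V` raises it by at most the payoff earned by the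
Gibbs state plus `(a β)² σ_t` (`logPartition_add_smul_le`). Up to `log N / σ_T`, the final potential
dominates the cumulative payoff of every fixed state (`trace_mul_le_logPartition`). Since the step
sizes sum to `O(η √T)`, the block bound `sum_trace_sub_gibbs_le` follows.

The noncommutative difficulty lies in the smoothness of `logPartition`. No derivative of the matrix
exponential is taken: for Hermitian `A` and `B`, each `tr (f(A) g(B))` is an integral over pairs of
eigenvalues with one common nonnegative weight (`exists_trace_cfc_mul_cfc`). Trace inequalities thus
reduce to scalar ones, here convexity of `exp` and the bound of the logarithmic mean by the
arithmetic mean. -/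

namespace OnlineMIMO

/-! ### Functional calculus and joint spectral weights of Hermitian matrices. -/

section Spectral

open Matrix

variable {ι : Type*} [Fintype ι] [DecidableEq ι]

lemma cfc_eq_conj {A : Matrix ι ι ℂ} (hA : A.IsHermitian) (f : ℝ → ℝ) :
    hA.cfc f = (hA.eigenvectorUnitary : Matrix ι ι ℂ) *
      diagonal (fun i => (f (hA.eigenvalues i) : ℂ)) *
        star (hA.eigenvectorUnitary : Matrix ι ι ℂ) := rfl

lemma cfc_id_eq {A : Matrix ι ι ℂ} (hA : A.IsHermitian) : hA.cfc (fun x => x) = A := by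
  conv_rhs => rw [hA.spectral_theorem]
  rfl

lemma cfc_const_eq {A : Matrix ι ι ℂ} (hA : A.IsHermitian) (c : ℝ) :
    hA.cfc (fun _ => c) = (c : ℂ) • 1 := by
  rw [cfc_eq_conj, show (diagonal fun _ : ι => (c : ℂ)) = (c : ℂ) • (1 : Matrix ι ι ℂ) by
    rw [smul_one_eq_diagonal]]
  simp

lemma cfc_mul_cfc {A : Matrix ι ι ℂ} (hA : A.IsHermitian) (f g : ℝ → ℝ) :
    hA.cfc f * hA.cfc g = hA.cfc (fun x => f x * g x) := by
  simp only [Matrix.IsHermitian.cfc, ← map_mul, diagonal_mul_diagonal]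
  congr 2
  ext i
  simp

lemma smul_cfc {A : Matrix ι ι ℂ} (hA : A.IsHermitian) (c : ℝ) (f : ℝ → ℝ) :
    (c : ℂ) • hA.cfc f = hA.cfc (fun x => c * f x) := by
  rw [← cfc_mul_cfc hA (fun _ => c) f, cfc_const_eq, smul_mul_assoc, one_mul]

lemma cfc_sub_cfc {A : Matrix ι ι ℂ} (hA : A.IsHermitian) (f g : ℝ → ℝ) :
    hA.cfc f - hA.cfc g = hA.cfc (fun x => f x - g x) := by
  simp only [Matrix.IsHermitian.cfc, ← map_sub, diagonal_sub]
  congr 2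
  ext i
  simp

lemma cfc_sub_const {A : Matrix ι ι ℂ} (hA : A.IsHermitian) (c : ℝ) :
    hA.cfc (fun x => x - c) = A - (c : ℂ) • 1 := by
  rw [← cfc_sub_cfc hA (fun x => x), cfc_id_eq, cfc_const_eq]

lemma exp_smul_eq_cfc {A : Matrix ι ι ℂ} (hA : A.IsHermitian) (c : ℝ) :
    NormedSpace.exp (c • A) = hA.cfc (fun x => Real.exp (c * x)) := by
  have h : c • A = (hA.eigenvectorUnitary : Matrix ι ι ℂ) *
      diagonal (fun i => ((c * hA.eigenvalues i : ℝ) : ℂ)) *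
        star (hA.eigenvectorUnitary : Matrix ι ι ℂ) := by
    rw [← cfc_eq_conj hA (fun x => c * x), ← smul_cfc hA c (fun x => x), cfc_id_eq]
    rfl
  have h2 : (hA.eigenvectorUnitary : Matrix ι ι ℂ)⁻¹ =
      star (hA.eigenvectorUnitary : Matrix ι ι ℂ) :=
    Matrix.inv_eq_left_inv (Unitary.coe_star_mul_self _)
  have h3 : IsUnit (hA.eigenvectorUnitary : Matrix ι ι ℂ) :=
    ⟨Unitary.toUnits hA.eigenvectorUnitary, rfl⟩
  rw [h, ← h2, Matrix.exp_conj _ _ h3, h2, Matrix.exp_diagonal, cfc_eq_conj]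
  congr 3
  ext i
  rw [Pi.coe_exp, ← Complex.exp_eq_exp_ℂ, Complex.ofReal_exp]

lemma exp_eq_cfc {A : Matrix ι ι ℂ} (hA : A.IsHermitian) :
    NormedSpace.exp A = hA.cfc Real.exp := by
  have := exp_smul_eq_cfc hA 1
  simpa using this

lemma trace_cfc {A : Matrix ι ι ℂ} (hA : A.IsHermitian) (f : ℝ → ℝ) :
    (hA.cfc f).trace = ((∑ i, f (hA.eigenvalues i) : ℝ) : ℂ) := by
  rw [cfc_eq_conj, trace_mul_cycle, Unitary.coe_star_mul_self, one_mul, trace_diagonal]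
  push_cast
  rfl

/-- Traces of products of functions of two Hermitian matrices are integrals over the joint
spectral measure, a nonnegative weight on pairs of eigenvalues. -/
lemma exists_trace_cfc_mul_cfc {A B : Matrix ι ι ℂ} (hA : A.IsHermitian) (hB : B.IsHermitian) :
    ∃ w : ι → ι → ℝ, (∀ i j, 0 ≤ w i j) ∧ ∀ f g : ℝ → ℝ,
      (hA.cfc f * hB.cfc g).trace =
        ((∑ i, ∑ j, w i j * (f (hA.eigenvalues i) * g (hB.eigenvalues j)) : ℝ) : ℂ) := by
  set U : Matrix ι ι ℂ := hA.eigenvectorUnitary.1 with hU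
  set V : Matrix ι ι ℂ := hB.eigenvectorUnitary.1 with hV
  -- The weights are the squared overlaps of the two eigenbases; they do not depend on `f` and `g`.
  refine ⟨fun i j => Complex.normSq ((star U * V) i j), fun i j => Complex.normSq_nonneg _, ?_⟩
  intro f g
  rw [cfc_eq_conj, cfc_eq_conj, ← hU, ← hV]
  have h : (U * diagonal (fun i => (f (hA.eigenvalues i) : ℂ)) * star U *
      (V * diagonal (fun i => (g (hB.eigenvalues i) : ℂ)) * star V)).trace =
      (diagonal (fun i => (f (hA.eigenvalues i) : ℂ)) * (star U * V) *
        diagonal (fun i => (g (hB.eigenvalues i) : ℂ)) * star (star U * V)).trace := by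
    rw [star_mul, star_star, mul_assoc U, mul_assoc U, trace_mul_comm U]
    simp only [mul_assoc]
  rw [h]
  simp only [trace, diag_apply, mul_apply (N := star (star U * V)), mul_diagonal, diagonal_mul]
  push_cast
  refine Finset.sum_congr rfl fun i _ => Finset.sum_congr rfl fun j _ => ?_
  rw [star_apply, Complex.normSq_eq_conj_mul_self]
  simp only [RCLike.star_def]
  ring

/-- The trace of a positive semidefinite matrix against a function of a Hermitian one. -/
lemma exists_trace_mul_cfc {A R : Matrix ι ι ℂ} (hA : A.IsHermitian) (hR : R.PosSemidef) :
    ∃ w : ι → ℝ, (∀ i, 0 ≤ w i) ∧ ∀ f : ℝ → ℝ,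
      (hA.cfc f * R).trace = ((∑ i, w i * f (hA.eigenvalues i) : ℝ) : ℂ) := by
  obtain ⟨w, hw, h⟩ := exists_trace_cfc_mul_cfc hA hR.1
  refine ⟨fun i => ∑ j, w i j * hR.1.eigenvalues j,
    fun i => Finset.sum_nonneg fun j _ => mul_nonneg (hw i j) (hR.eigenvalues_nonneg j), ?_⟩
  intro f
  have := h f (fun x => x)
  rw [cfc_id_eq] at this
  rw [this]
  congr 1
  refine Finset.sum_congr rfl fun i _ => ?_
  rw [Finset.sum_mul]
  exact Finset.sum_congr rfl fun j _ => by ring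

end Spectral

/-! ### Scalar inequalities for the exponential. -/

lemma mul_exp_sub_one_le (d : ℝ) : d * (Real.exp d - 1) ≤ d ^ 2 * (Real.exp d + 1) / 2 := by
  let f : ℝ → ℝ := fun x => x * (Real.exp x + 1) / 2 - (Real.exp x - 1)
  have hd : ∀ x, HasDerivAt f ((1 * (Real.exp x + 1) + x * Real.exp x) / 2 - Real.exp x) x :=
    fun x => ((((hasDerivAt_id x).mul ((Real.hasDerivAt_exp x).add_const 1)).div_const 2).sub
      ((Real.hasDerivAt_exp x).sub_const 1))
  -- The derivative is `(1 - (1 - x) eˣ) / 2`, nonnegative because `1 - x ≤ e⁻ˣ`. As `f 0 = 0`, `f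
  -- d` has the sign of `d`.
  have hmono : Monotone f := by
    refine monotone_of_deriv_nonneg (fun x => (hd x).differentiableAt) fun x => ?_
    rw [(hd x).deriv]
    have h1 := Real.add_one_le_exp (-x)
    have h2 : Real.exp (-x) * Real.exp x = 1 := by rw [← Real.exp_add]; simp
    nlinarith [mul_le_mul_of_nonneg_right h1 (Real.exp_pos x).le]
  have h0 : f 0 = 0 := by simp [f]
  have key : 0 ≤ d * f d := by
    rcases le_total 0 d with h | h
    · exact mul_nonneg h (h0 ▸ hmono h)
    · exact mul_nonneg_of_nonpos_of_nonpos h (h0 ▸ hmono h)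
  simp only [f] at key
  nlinarith

/-- The logarithmic mean is at most the arithmetic mean. -/
lemma sub_mul_exp_sub_exp_le (a b : ℝ) :
    (b - a) * (Real.exp b - Real.exp a) ≤ (b - a) ^ 2 * (Real.exp b + Real.exp a) / 2 := by
  have h := mul_le_mul_of_nonneg_left (mul_exp_sub_one_le (b - a)) (Real.exp_pos a).le
  have h2 : Real.exp a * Real.exp (b - a) = Real.exp b := by rw [← Real.exp_add]; congr 1; ring
  rw [← h2]
  nlinarith

/-! ### Gibbs states and the log-partition function. -/

section Gibbs

open Matrix

variable {ι : Type*} [Fintype ι] [DecidableEq ι]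

/-- The Gibbs state `exp A / tr (exp A)`. -/
noncomputable def gibbs (A : Matrix ι ι ℂ) : Matrix ι ι ℂ :=
  (NormedSpace.exp A).trace⁻¹ • NormedSpace.exp A

/-- The log-partition function `log (tr (exp A))`. -/
noncomputable def logPartition (A : Matrix ι ι ℂ) : ℝ :=
  Real.log (NormedSpace.exp A).trace.re

lemma logPartition_eq {A : Matrix ι ι ℂ} (hA : A.IsHermitian) :
    logPartition A = Real.log (∑ i, Real.exp (hA.eigenvalues i)) := by
  rw [logPartition, exp_eq_cfc hA, trace_cfc, Complex.ofReal_re]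

variable [Nonempty ι]

lemma gibbs_eq_cfc {A : Matrix ι ι ℂ} (hA : A.IsHermitian) :
    gibbs A = hA.cfc (fun x => Real.exp (x - logPartition A)) := by
  have hpos : 0 < ∑ i, Real.exp (hA.eigenvalues i) :=
    Finset.sum_pos (fun i _ => Real.exp_pos _) Finset.univ_nonempty
  rw [gibbs, exp_eq_cfc hA, trace_cfc, ← Complex.ofReal_inv, smul_cfc]
  congr 1
  ext x
  rw [logPartition_eq hA, Real.exp_sub, Real.exp_log hpos]
  field_simp

lemma trace_gibbs {A : Matrix ι ι ℂ} (hA : A.IsHermitian) : (gibbs A).trace = 1 := by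
  have hpos : 0 < ∑ i, Real.exp (hA.eigenvalues i) :=
    Finset.sum_pos (fun i _ => Real.exp_pos _) Finset.univ_nonempty
  rw [gibbs, trace_smul, exp_eq_cfc hA, trace_cfc, smul_eq_mul, inv_mul_cancel₀]
  exact_mod_cast hpos.ne'

lemma posSemidef_gibbs {A : Matrix ι ι ℂ} (hA : A.IsHermitian) : (gibbs A).PosSemidef := by
  rw [gibbs_eq_cfc hA, cfc_eq_conj, star_eq_conjTranspose]
  refine PosSemidef.mul_mul_conjTranspose_same (PosSemidef.diagonal fun i => ?_) _
  exact Complex.zero_le_real.2 (Real.exp_pos _).le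

/-- The log-partition function is convex, with the Gibbs states as its gradients. -/
lemma trace_sub_mul_gibbs_le {A B : Matrix ι ι ℂ} (hA : A.IsHermitian) (hB : B.IsHermitian) :
    ((B - A) * gibbs A).trace.re ≤ logPartition B - logPartition A := by
  obtain ⟨w, hw, h⟩ := exists_trace_cfc_mul_cfc hA hB
  set s := logPartition A
  set s' := logPartition B
  have e1 := h (fun x => Real.exp (x - s)) (fun x => x)
  have e2 := h (fun x => x * Real.exp (x - s)) (fun _ => 1)
  have e3 := h (fun x => Real.exp (x - s)) (fun _ => 1)
  have e4 := h (fun _ => 1) (fun x => Real.exp (x - s'))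
  rw [← gibbs_eq_cfc hA, cfc_id_eq hB] at e1
  rw [← cfc_mul_cfc hA (fun x => x), ← gibbs_eq_cfc hA, cfc_id_eq hA, cfc_const_eq] at e2
  rw [← gibbs_eq_cfc hA, cfc_const_eq] at e3
  rw [← gibbs_eq_cfc hB, cfc_const_eq] at e4
  simp only [Complex.ofReal_one, one_smul, one_mul, mul_one, trace_gibbs hA, trace_gibbs hB]
    at e2 e3 e4
  have f1 := congrArg Complex.re e1
  have f2 := congrArg Complex.re e2
  have f3 := congrArg Complex.re e3
  have f4 := congrArg Complex.re e4
  simp only [Complex.ofReal_re, Complex.one_re] at f1 f2 f3 f4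
  rw [sub_mul, trace_sub, Complex.sub_re, trace_mul_comm B, f1, f2]
  -- This sum is the relative entropy of `gibbs A` with respect to `gibbs B`; each term is
  -- nonnegative by the tangent-line bound for `exp`.
  have key : 0 ≤ ∑ i, ∑ j, w i j * (Real.exp (hB.eigenvalues j - s') -
      Real.exp (hA.eigenvalues i - s) - Real.exp (hA.eigenvalues i - s) *
        ((hB.eigenvalues j - s') - (hA.eigenvalues i - s))) := by
    refine Finset.sum_nonneg fun i _ => Finset.sum_nonneg fun j _ => mul_nonneg (hw i j) ?_
    set a := hA.eigenvalues i - s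
    set b := hB.eigenvalues j - s'
    have h1 := mul_le_mul_of_nonneg_left (Real.add_one_le_exp (b - a)) (Real.exp_pos a).le
    rw [← Real.exp_add, add_sub_cancel] at h1
    linarith
  have expand : ∑ i, ∑ j, w i j * (Real.exp (hB.eigenvalues j - s') -
      Real.exp (hA.eigenvalues i - s) - Real.exp (hA.eigenvalues i - s) *
        ((hB.eigenvalues j - s') - (hA.eigenvalues i - s))) =
      (∑ i, ∑ j, w i j * Real.exp (hB.eigenvalues j - s')) -
      (1 + s - s') * (∑ i, ∑ j, w i j * Real.exp (hA.eigenvalues i - s)) -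
      (∑ i, ∑ j, w i j * (Real.exp (hA.eigenvalues i - s) * hB.eigenvalues j)) +
      (∑ i, ∑ j, w i j * (hA.eigenvalues i * Real.exp (hA.eigenvalues i - s))) := by
    simp only [Finset.mul_sum, ← Finset.sum_sub_distrib, ← Finset.sum_add_distrib]
    refine Finset.sum_congr rfl fun i _ => Finset.sum_congr rfl fun j _ => ?_
    ring
  rw [expand, ← f3, ← f4] at key
  linarith

/-- Lipschitz continuity of the Gibbs map, tested on the increment: the discrete analogue of the
bound on the Hessian of the log-partition function. -/
lemma trace_sub_mul_gibbs_sub_gibbs_le {A B C : Matrix ι ι ℂ} (hA : A.IsHermitian)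
    (hB : B.IsHermitian)
    (hC : C = B - A - ((logPartition B - logPartition A : ℝ) : ℂ) • 1) :
    ((B - A) * (gibbs B - gibbs A)).trace.re ≤ (C * C * (gibbs B + gibbs A)).trace.re / 2 := by
  obtain ⟨w, hw, h⟩ := exists_trace_cfc_mul_cfc hA hB
  set s := logPartition A with hs
  set s' := logPartition B with hs'
  let qA : ℝ → ℝ := fun x => Real.exp (x - s)
  let qB : ℝ → ℝ := fun x => Real.exp (x - s')
  let a' : ℝ → ℝ := fun x => x - s
  let b' : ℝ → ℝ := fun x => x - s'
  -- `X` and `Y` are the logarithms of the two Gibbs states.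
  set X := A - (s : ℂ) • 1 with hX
  set Y := B - (s' : ℂ) • 1 with hY
  have hC' : C = Y - X := by
    rw [hC, hX, hY, Complex.ofReal_sub, sub_smul]
    abel
  -- Scalar shifts are invisible here because both states have trace one.
  have lhs : ((B - A) * (gibbs B - gibbs A)).trace = ((Y - X) * (gibbs B - gibbs A)).trace := by
    have : B - A = (Y - X) + ((s' - s : ℝ) : ℂ) • 1 := by
      rw [← hC', hC]; abel
    rw [this, add_mul, trace_add, smul_mul_assoc, one_mul, trace_smul, trace_sub, trace_gibbs hA,
      trace_gibbs hB]
    simp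
  have hXc : X = hA.cfc a' := (cfc_sub_const hA s).symm
  have hYc : Y = hB.cfc b' := (cfc_sub_const hB s').symm
  have hQA : gibbs A = hA.cfc qA := gibbs_eq_cfc hA
  have hQB : gibbs B = hB.cfc qB := gibbs_eq_cfc hB
  have h1A : (1 : Matrix ι ι ℂ) = hA.cfc (fun _ => 1) := by rw [cfc_const_eq]; simp
  have h1B : (1 : Matrix ι ι ℂ) = hB.cfc (fun _ => 1) := by rw [cfc_const_eq]; simp
  -- Cyclicity and inserted identities bring every term to the form `tr (f(A) g(B))`; the comparison
  -- is then made pair by pair of eigenvalues.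
  have l1 : (Y * gibbs B).trace = (1 * (Y * gibbs B)).trace := by rw [one_mul]
  have l2 : (Y * gibbs A).trace = (gibbs A * Y).trace := trace_mul_comm _ _
  have l4 : (X * gibbs A).trace = (X * gibbs A * 1).trace := by rw [mul_one]
  have r1 : (Y * Y * gibbs B).trace = (1 * (Y * Y * gibbs B)).trace := by rw [one_mul]
  have r2 : (Y * X * gibbs B).trace = (X * (gibbs B * Y)).trace := by
    rw [mul_assoc, trace_mul_comm, mul_assoc]
  have r3 : (X * Y * gibbs B).trace = (X * (Y * gibbs B)).trace := by rw [mul_assoc]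
  have r5 : (Y * Y * gibbs A).trace = (gibbs A * (Y * Y)).trace := trace_mul_comm _ _
  have r6 : (Y * X * gibbs A).trace = (X * gibbs A * Y).trace := by
    rw [mul_assoc, trace_mul_comm]
  have r7 : (X * Y * gibbs A).trace = (gibbs A * X * Y).trace := by
    rw [trace_mul_comm, mul_assoc]
  have r8 : (X * X * gibbs A).trace = (X * X * gibbs A * 1).trace := by rw [mul_one]
  have rhs : (C * C * (gibbs B + gibbs A)).trace =
      (Y * Y * gibbs B).trace - (Y * X * gibbs B).trace - (X * Y * gibbs B).trace +
      (X * X * gibbs B).trace + (Y * Y * gibbs A).trace - (Y * X * gibbs A).trace -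
      (X * Y * gibbs A).trace + (X * X * gibbs A).trace := by
    rw [hC']
    simp only [mul_sub, sub_mul, mul_add, trace_add, trace_sub]
    ring
  have lhs2 : ((Y - X) * (gibbs B - gibbs A)).trace =
      (Y * gibbs B).trace - (Y * gibbs A).trace - (X * gibbs B).trace + (X * gibbs A).trace := by
    simp only [mul_sub, sub_mul, trace_sub]
    ring
  rw [lhs, lhs2, rhs, l1, l2, l4, r1, r2, r3, r5, r6, r7, r8]
  nth_rw 1 [h1A]
  nth_rw 1 [h1B]
  nth_rw 1 [h1A]
  nth_rw 1 [h1B]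
  rw [hQA, hQB, hXc, hYc]
  simp only [cfc_mul_cfc, h, Complex.add_re, Complex.sub_re, Complex.ofReal_re]
  simp only [← Finset.sum_sub_distrib, ← Finset.sum_add_distrib, Finset.sum_div]
  refine Finset.sum_le_sum fun i _ => Finset.sum_le_sum fun j _ => ?_
  have key := mul_le_mul_of_nonneg_left
    (sub_mul_exp_sub_exp_le (hA.eigenvalues i - s) (hB.eigenvalues j - s')) (hw i j)
  simp only [qA, qB, a', b']
  linarith

/-- Smoothness of the log-partition function along positive semidefinite increments. -/
lemma logPartition_add_smul_le {A V : Matrix ι ι ℂ} (hA : A.IsHermitian) (hV : V.PosSemidef)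
    {β r : ℝ} (hβ : ∀ i, hV.1.eigenvalues i ≤ β) (hr : 0 ≤ r) :
    logPartition (A + r • V) ≤ logPartition A + r * (V * gibbs A).trace.re + (r * β) ^ 2 := by
  have hB : (A + r • V).IsHermitian := hA.add (hV.smul hr).1
  set B := A + r • V with hBdef
  have hBA : B - A = (r : ℂ) • V := by rw [hBdef, add_sub_cancel_left]; rfl
  have hBA' : A - B = (-r : ℂ) • V := by rw [← neg_sub, hBA, neg_smul]
  set δ := logPartition B - logPartition A with hδ
  have low := trace_sub_mul_gibbs_le hA hB
  have high := trace_sub_mul_gibbs_le hB hA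
  have lip := trace_sub_mul_gibbs_sub_gibbs_le hA hB rfl
  rw [mul_sub, trace_sub, Complex.sub_re] at lip
  rw [hBA, smul_mul_assoc, trace_smul, smul_eq_mul, Complex.re_ofReal_mul] at low
  rw [hBA', smul_mul_assoc, trace_smul, smul_eq_mul, ← Complex.ofReal_neg,
    Complex.re_ofReal_mul] at high
  rw [hBA, smul_mul_assoc, trace_smul, smul_eq_mul, Complex.re_ofReal_mul, smul_mul_assoc,
    trace_smul, smul_eq_mul, Complex.re_ofReal_mul, ← hδ] at lip
  have hC : (r : ℂ) • V - (δ : ℂ) • 1 = hV.1.cfc (fun x => r * x - δ) := by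
    rw [← cfc_sub_cfc, ← smul_cfc, cfc_id_eq, cfc_const_eq]
  rw [hC, cfc_mul_cfc, mul_add, trace_add, Complex.add_re] at lip
  obtain ⟨w, hw, e⟩ := exists_trace_mul_cfc hV.1 (posSemidef_gibbs hA)
  obtain ⟨w', hw', e'⟩ := exists_trace_mul_cfc hV.1 (posSemidef_gibbs hB)
  have mass : ∑ i, w i = 1 := by
    have := e (fun _ => 1)
    rw [cfc_const_eq] at this
    simp only [Complex.ofReal_one, one_smul, one_mul, mul_one, trace_gibbs hA] at this
    exact_mod_cast this.symm
  have mass' : ∑ i, w' i = 1 := by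
    have := e' (fun _ => 1)
    rw [cfc_const_eq] at this
    simp only [Complex.ofReal_one, one_smul, one_mul, mul_one, trace_gibbs hB] at this
    exact_mod_cast this.symm
  have tV := e (fun x => x)
  have tV' := e' (fun x => x)
  rw [cfc_id_eq] at tV tV'
  rw [tV, Complex.ofReal_re] at low
  rw [tV', Complex.ofReal_re] at high
  rw [e, e', Complex.ofReal_re, Complex.ofReal_re, tV, tV', Complex.ofReal_re,
    Complex.ofReal_re] at lip
  rw [tV, Complex.ofReal_re]
  -- Convexity at the two endpoints puts `δ` in `[0, r β]`, the interval that also contains the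
  -- eigenvalues of `r • V`. Hence the eigenvalues of `r • V - δ` are at most `r β` in absolute
  -- value, and each Gibbs mean of its square is at most `(r β)²`.
  have hδ0 : 0 ≤ δ := le_trans (mul_nonneg hr (Finset.sum_nonneg fun i _ =>
    mul_nonneg (hw i) (hV.eigenvalues_nonneg i))) low
  have hδβ : δ ≤ r * β := by
    have h1 : ∑ i, w' i * hV.1.eigenvalues i ≤ β :=
      calc ∑ i, w' i * hV.1.eigenvalues i ≤ ∑ i, w' i * β :=
            Finset.sum_le_sum fun i _ => mul_le_mul_of_nonneg_left (hβ i) (hw' i)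
        _ = β := by rw [← Finset.sum_mul, mass', one_mul]
    have h2 := mul_le_mul_of_nonneg_left h1 hr
    linarith
  have hsq : ∀ i, (r * hV.1.eigenvalues i - δ) * (r * hV.1.eigenvalues i - δ) ≤ (r * β) ^ 2 := by
    intro i
    have h1 := mul_le_mul_of_nonneg_left (hβ i) hr
    have h2 := mul_nonneg hr (hV.eigenvalues_nonneg i)
    rw [← sq]
    exact sq_le_sq' (by linarith) (by linarith)
  have hvar : ∀ u : ι → ℝ, (∀ i, 0 ≤ u i) → ∑ i, u i = 1 →
      ∑ i, u i * ((r * hV.1.eigenvalues i - δ) * (r * hV.1.eigenvalues i - δ)) ≤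
        (r * β) ^ 2 := by
    intro u hu hu1
    calc _ ≤ ∑ i, u i * (r * β) ^ 2 :=
          Finset.sum_le_sum fun i _ => mul_le_mul_of_nonneg_left (hsq i) (hu i)
      _ = _ := by rw [← Finset.sum_mul, hu1, one_mul]
  have v1 := hvar w hw mass
  have v2 := hvar w' hw' mass'
  linarith

/-- A state averages the eigenvalues of `A` with weights of total mass one, and each eigenvalue is
at most the log-sum-exp of all of them. -/
lemma trace_mul_le_logPartition {A R : Matrix ι ι ℂ} (hA : A.IsHermitian) (hR : R.PosSemidef)
    (hR1 : R.trace = 1) : (A * R).trace.re ≤ logPartition A := by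
  obtain ⟨w, hw, e⟩ := exists_trace_mul_cfc hA hR
  have mass : ∑ i, w i = 1 := by
    have := e (fun _ => 1)
    rw [cfc_const_eq] at this
    simp only [Complex.ofReal_one, one_smul, one_mul, mul_one, hR1] at this
    exact_mod_cast this.symm
  have t := e (fun x => x)
  rw [cfc_id_eq] at t
  rw [t, Complex.ofReal_re, logPartition_eq hA]
  calc ∑ i, w i * hA.eigenvalues i
      ≤ ∑ i, w i * Real.log (∑ i, Real.exp (hA.eigenvalues i)) := by
        refine Finset.sum_le_sum fun i _ => mul_le_mul_of_nonneg_left ?_ (hw i)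
        rw [Real.le_log_iff_exp_le
          (Finset.sum_pos (fun i _ => Real.exp_pos _) Finset.univ_nonempty)]
        exact Finset.single_le_sum (f := fun i => Real.exp (hA.eigenvalues i))
          (fun i _ => (Real.exp_pos _).le) (Finset.mem_univ i)
    _ = _ := by rw [← Finset.sum_mul, mass, one_mul]

/-- Monotonicity of the normalized free energy in the inverse temperature. -/
lemma logPartition_smul_mono {A : Matrix ι ι ℂ} (hA : A.IsHermitian) {r s : ℝ} (hr : 0 < r)
    (hrs : r ≤ s) :
    (logPartition (r • A) - Real.log (Fintype.card ι)) / r ≤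
      (logPartition (s • A) - Real.log (Fintype.card ι)) / s := by
  have hs : 0 < s := hr.trans_le hrs
  have hN : (0 : ℝ) < Fintype.card ι := by exact_mod_cast Fintype.card_pos
  have hform : ∀ c : ℝ, logPartition (c • A) - Real.log (Fintype.card ι) =
      Real.log (∑ i, (Fintype.card ι : ℝ)⁻¹ * Real.exp (c * hA.eigenvalues i)) := by
    intro c
    rw [logPartition, exp_smul_eq_cfc hA, trace_cfc, Complex.ofReal_re, ← Finset.mul_sum,
      Real.log_mul (inv_ne_zero hN.ne')
        (Finset.sum_pos (fun i _ => Real.exp_pos _) Finset.univ_nonempty).ne', Real.log_inv]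
    ring
  have hpos : ∀ c : ℝ, 0 < ∑ i, (Fintype.card ι : ℝ)⁻¹ * Real.exp (c * hA.eigenvalues i) :=
    fun c => Finset.sum_pos (fun i _ => mul_pos (inv_pos.2 hN) (Real.exp_pos _))
      Finset.univ_nonempty
  rw [hform, hform]
  -- Power mean inequality with exponent `s / r ≥ 1` for the uniform average of the numbers `exp (r
  -- λ_i)`.
  have hJ := Real.rpow_arith_mean_le_arith_mean_rpow Finset.univ
    (fun _ : ι => (Fintype.card ι : ℝ)⁻¹) (fun i => Real.exp (r * hA.eigenvalues i))
    (fun i _ => (inv_pos.2 hN).le)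
    (by rw [Finset.sum_const, Finset.card_univ, nsmul_eq_mul, mul_inv_cancel₀ hN.ne'])
    (fun i _ => (Real.exp_pos _).le) ((one_le_div hr).2 hrs)
  have hexp : ∀ i, Real.exp (r * hA.eigenvalues i) ^ (s / r) =
      Real.exp (s * hA.eigenvalues i) := by
    intro i
    rw [← Real.exp_mul]
    congr 1
    field_simp
  simp only [hexp] at hJ
  have hlog := Real.log_le_log (Real.rpow_pos_of_pos (hpos r) _) hJ
  rw [Real.log_rpow (hpos r)] at hlog
  rw [div_le_div_iff₀ hr hs]
  have := mul_le_mul_of_nonneg_left hlog hr.le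
  rw [← mul_assoc, mul_div_cancel₀ _ hr.ne'] at this
  linarith

end Gibbs

/-! ### Step sizes. -/

/-- `η / √t`, with the value `η` at `t = 0`. -/
noncomputable def stepSize (η : ℝ) (t : ℕ) : ℝ := if t = 0 then η else η / √(t : ℝ)

lemma stepSize_pos {η : ℝ} (hη : 0 < η) (t : ℕ) : 0 < stepSize η t := by
  unfold stepSize
  split_ifs with h
  · exact hη
  · have : (0 : ℝ) < t := by exact_mod_cast Nat.pos_of_ne_zero h
    positivity

lemma stepSize_succ_le {η : ℝ} (hη : 0 < η) (t : ℕ) : stepSize η (t + 1) ≤ stepSize η t := by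
  unfold stepSize
  rw [if_neg (Nat.succ_ne_zero t)]
  split_ifs with h
  · simp [h]
  · have : (0 : ℝ) < t := by exact_mod_cast Nat.pos_of_ne_zero h
    gcongr
    simp

lemma sum_stepSize_le {η : ℝ} (hη : 0 < η) (T : ℕ) :
    ∑ t ∈ Finset.range T, stepSize η t ≤ η * (3 * √(T : ℝ)) := by
  induction T with
  | zero => simp
  | succ t ih =>
    rw [Finset.sum_range_succ]
    rcases Nat.eq_zero_or_pos t with h | h
    · subst h
      simp [stepSize]
      linarith
    · have ht : (0 : ℝ) < t := by exact_mod_cast h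
      have ht1 : (1 : ℝ) ≤ t := by exact_mod_cast h
      have h0 : 0 < √(t : ℝ) := Real.sqrt_pos.2 ht
      have h1 : √(t : ℝ) ^ 2 = t := Real.sq_sqrt ht.le
      have h2 : √((t + 1 : ℕ) : ℝ) ^ 2 = t + 1 := by
        rw [Real.sq_sqrt (by positivity)]; push_cast; ring
      have h3 : 0 < √((t + 1 : ℕ) : ℝ) := Real.sqrt_pos.2 (by positivity)
      have key : 1 / √(t : ℝ) ≤ 3 * √((t + 1 : ℕ) : ℝ) - 3 * √(t : ℝ) := by
        rw [div_le_iff₀ h0]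
        -- Squared, this is `(t + 1/3)² ≤ t (t + 1)`, true once `t ≥ 1/3`. The constant 3 is chosen
        -- so that this increment bound already holds at `t = 1`, where 2 would fail.
        have h4 : √(t : ℝ) ^ 2 + 1 / 3 ≤ √((t + 1 : ℕ) : ℝ) * √(t : ℝ) := by
          rw [h1, ← Real.sqrt_mul (by positivity)]
          refine Real.le_sqrt_of_sq_le ?_
          push_cast
          nlinarith
        nlinarith
      have hst : stepSize η t = η * (1 / √(t : ℝ)) := by
        rw [stepSize, if_neg h.ne']; ring
      rw [hst]
      nlinarith [mul_le_mul_of_nonneg_left key hη.le]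

/-! ### Regret on a single spectrahedron. -/

section Block

open Matrix

variable {ι : Type*} [Fintype ι] [DecidableEq ι] [Nonempty ι]

/-- Regret bound for matrix exponential learning with step sizes `η / √t` on one spectrahedron,
against a stream of linear payoffs `a • V t`. -/
lemma sum_trace_sub_gibbs_le {V Y : ℕ → Matrix ι ι ℂ} {η a β : ℝ} (hη : 0 < η) (ha : 0 ≤ a)
    (hV : ∀ t, (V t).PosSemidef) (hβ : ∀ t i, (hV t).1.eigenvalues i ≤ β)
    (hY0 : Y 0 = 0) (hY : ∀ t, Y (t + 1) = Y t + a • V t)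
    {R : Matrix ι ι ℂ} (hR : R.PosSemidef) (hR1 : R.trace = 1) {T : ℕ} (hT : 1 ≤ T) :
    ∑ t ∈ Finset.range T, a * (V t * (R - gibbs ((η / √(t : ℝ)) • Y t))).trace.re ≤
      √(T : ℝ) * (Real.log (Fintype.card ι) / η + 3 * (a * β) ^ 2 * η) := by
  have hYh : ∀ t, (Y t).IsHermitian := by
    intro t
    induction t with
    | zero => rw [hY0]; exact isHermitian_zero
    | succ t ih => rw [hY]; exact ih.add ((hV t).smul ha).1
  have hsmul : ∀ (c : ℝ) t, (c • Y t).IsHermitian := fun c t => by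
    rw [IsHermitian, conjTranspose_smul, (hYh t).eq]; simp
  -- In Lean `η / √0 = 0`, whereas the potential needs a positive step size; at `t = 0` the score
  -- vanishes, so the prefactor is immaterial.
  have hstep : ∀ t : ℕ, (η / √(t : ℝ)) • Y t = stepSize η t • Y t := by
    intro t
    unfold stepSize
    split_ifs with h
    · subst h; simp [hY0]
    · rfl
  have hscore : ∀ T, ∑ t ∈ Finset.range T, a * (V t * R).trace.re = (Y T * R).trace.re := by
    intro T
    induction T with
    | zero => simp [hY0]
    | succ t ih =>
      rw [Finset.sum_range_succ, ih, hY, add_mul, trace_add, Complex.add_re, smul_mul_assoc,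
        trace_smul, Complex.smul_re, smul_eq_mul]
  have hpot : ∀ T, (logPartition (stepSize η T • Y T) - Real.log (Fintype.card ι)) /
      stepSize η T ≤ ∑ t ∈ Finset.range T, (a * (V t * gibbs ((η / √(t : ℝ)) • Y t)).trace.re +
        (a * β) ^ 2 * stepSize η t) := by
    intro T
    induction T with
    | zero => simp [hY0, logPartition]
    | succ t ih =>
      have hs := stepSize_pos hη t
      -- The step size is first raised back to its old value, so that the smoothness bound compares
      -- the two scores at one temperature.
      refine (logPartition_smul_mono (hYh (t + 1)) (stepSize_pos hη _)
        (stepSize_succ_le hη t)).trans ?_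
      rw [Finset.sum_range_succ]
      have h1 := logPartition_add_smul_le (hsmul (stepSize η t) t) (hV t) (hβ t)
        (mul_nonneg hs.le ha)
      rw [mul_smul, ← smul_add, ← hY] at h1
      rw [hstep]
      rw [div_le_iff₀ hs] at ih ⊢
      nlinarith
  have hfin := trace_mul_le_logPartition (hsmul (stepSize η T) T) hR hR1
  rw [smul_mul_assoc, trace_smul, Complex.smul_re, smul_eq_mul] at hfin
  have hs := stepSize_pos hη T
  have hT0 : 0 < √(T : ℝ) := Real.sqrt_pos.2 (by exact_mod_cast hT)
  have hsT : stepSize η T = η / √(T : ℝ) := by rw [stepSize, if_neg (by omega)]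
  have h1 : (Y T * R).trace.re - Real.log (Fintype.card ι) / stepSize η T ≤
      (logPartition (stepSize η T • Y T) - Real.log (Fintype.card ι)) / stepSize η T := by
    rw [sub_div]
    gcongr
    rw [le_div_iff₀ hs]
    linarith
  have h2 := h1.trans (hpot T)
  rw [Finset.sum_add_distrib, ← Finset.mul_sum _ _ ((a * β) ^ 2)] at h2
  have h3 := mul_le_mul_of_nonneg_left (sum_stepSize_le hη T) (sq_nonneg (a * β))
  have h4 : Real.log (Fintype.card ι) / stepSize η T =
      √(T : ℝ) * (Real.log (Fintype.card ι) / η) := by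
    rw [hsT]; field_simp
  simp only [mul_sub, trace_sub, Complex.sub_re, Finset.sum_sub_distrib]
  rw [hscore]
  rw [h4] at h2
  linarith

end Block

/-! ### Concavity of the rate. -/

section LogDet

open Matrix

variable {ν ι : Type*} [Fintype ν] [DecidableEq ν] [Fintype ι]

/-- Sum `log x ≤ x - 1` over the eigenvalues. This is concavity of `log det` at the identity, from
which the general case follows by congruence. -/
lemma log_det_le_trace_sub_card {S : Matrix ν ν ℂ} (hS : S.PosDef) :
    Real.log S.det.re ≤ S.trace.re - Fintype.card ν := by
  have hd : S.det = ((∏ i, hS.1.eigenvalues i : ℝ) : ℂ) := by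
    rw [hS.1.det_eq_prod_eigenvalues]; push_cast; rfl
  have ht : S.trace = ((∑ i, hS.1.eigenvalues i : ℝ) : ℂ) := by
    rw [hS.1.trace_eq_sum_eigenvalues]; push_cast; rfl
  rw [hd, ht, Complex.ofReal_re, Complex.ofReal_re,
    Real.log_prod (fun i _ => (hS.eigenvalues_pos i).ne')]
  calc ∑ i, Real.log (hS.1.eigenvalues i) ≤ ∑ i, (hS.1.eigenvalues i - 1) :=
        Finset.sum_le_sum fun i _ => Real.log_le_sub_one_of_pos (hS.eigenvalues_pos i)
    _ = _ := by simp [Finset.sum_sub_distrib]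

open scoped MatrixOrder Matrix.Norms.L2Operator in
lemma exists_inv_eq_conjTranspose_mul_self {X : Matrix ν ν ℂ} (hX : X.PosDef) :
    ∃ C : Matrix ν ν ℂ, X⁻¹ = Cᴴ * C ∧ IsUnit C := by
  obtain ⟨C, hC⟩ := CStarAlgebra.nonneg_iff_eq_star_mul_self.1 hX.inv.posSemidef.nonneg
  refine ⟨C, hC, ?_⟩
  have := hX.inv.isUnit
  rw [hC] at this
  rw [isUnit_iff_isUnit_det] at this ⊢
  rw [det_mul] at this
  exact isUnit_of_mul_isUnit_right this

/-- Concavity of `log det`. -/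
lemma log_det_sub_log_det_le {X X₀ : Matrix ν ν ℂ} (hX : X.PosDef) (hX₀ : X₀.PosDef) :
    Real.log X₀.det.re - Real.log X.det.re ≤ (X⁻¹ * (X₀ - X)).trace.re := by
  -- With `X⁻¹ = Cᴴ * C`, congruence by `C` sends `X` to the identity and `X₀` to a matrix of
  -- determinant `det X₀ / det X` and trace `tr (X⁻¹ X₀)`.
  obtain ⟨C, hC, hCu⟩ := exists_inv_eq_conjTranspose_mul_self hX
  have hS : (C * X₀ * Cᴴ).PosDef := hX₀.mul_mul_conjTranspose_same
    (Matrix.vecMul_injective_of_isUnit hCu)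
  have h := log_det_le_trace_sub_card hS
  have hXu : IsUnit X.det := (isUnit_iff_isUnit_det _).1 hX.isUnit
  have hdet : (C * X₀ * Cᴴ).det = X₀.det * (X.det)⁻¹ := by
    rw [← Ring.inverse_eq_inv', ← det_nonsing_inv, hC, det_mul, det_mul, det_mul]; ring
  have htr : (C * X₀ * Cᴴ).trace = (X⁻¹ * X₀).trace := by
    rw [trace_mul_comm, ← mul_assoc, ← hC]
  obtain ⟨hx, hx'⟩ := Complex.pos_iff.1 hX.det_pos
  obtain ⟨hx₀, hx₀'⟩ := Complex.pos_iff.1 hX₀.det_pos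
  have hre : X.det = (X.det.re : ℂ) := Complex.ext rfl (by simpa using hx'.symm)
  have hre₀ : X₀.det = (X₀.det.re : ℂ) := Complex.ext rfl (by simpa using hx₀'.symm)
  have : (C * X₀ * Cᴴ).det.re = X₀.det.re * X.det.re⁻¹ := by
    rw [hdet, hre, hre₀]; norm_cast
  rw [this, htr, Real.log_mul hx₀.ne' (inv_ne_zero hx.ne'), Real.log_inv] at h
  rw [mul_sub, nonsing_inv_mul _ hXu, trace_sub, trace_one, Complex.sub_re, Complex.natCast_re]
  linarith

lemma posDef_one_add {P : Matrix ι ι ℂ} (hP : P.PosSemidef) (H : Matrix ν ι ℂ) :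
    (1 + H * P * Hᴴ).PosDef :=
  PosDef.one.add_posSemidef (hP.mul_mul_conjTranspose_same H)

/-- Concavity of the rate of one channel. -/
lemma log_det_rate_sub_le {P P₀ : Matrix ι ι ℂ} (hP : P.PosSemidef) (hP₀ : P₀.PosSemidef)
    (H : Matrix ν ι ℂ) :
    Real.log (1 + H * P₀ * Hᴴ).det.re - Real.log (1 + H * P * Hᴴ).det.re ≤
      (Hᴴ * (1 + H * P * Hᴴ)⁻¹ * H * (P₀ - P)).trace.re := by
  refine (log_det_sub_log_det_le (posDef_one_add hP H) (posDef_one_add hP₀ H)).trans_eq ?_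
  congr 1
  rw [add_sub_add_left_eq_sub, ← Matrix.sub_mul, ← Matrix.mul_sub, ← Matrix.mul_assoc, trace_mul_comm]
  simp only [Matrix.mul_assoc]

lemma posSemidef_grad {P : Matrix ι ι ℂ} (hP : P.PosSemidef) (H : Matrix ν ι ℂ) :
    (Hᴴ * (1 + H * P * Hᴴ)⁻¹ * H).PosSemidef :=
  (posDef_one_add hP H).inv.posSemidef.conjTranspose_mul_mul_same H

end LogDet

/-! ### Spectral norm bounds. -/

section SpecNorm

open Matrix

open scoped Matrix.Norms.L2Operator

lemma specNorm_eq {a b : ℕ} (A : Matrix (Fin a) (Fin b) ℂ) : specNorm A = ‖A‖ := rfl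

lemma eigenvalues_le_specNorm {a : ℕ} {A : Matrix (Fin a) (Fin a) ℂ} (hA : A.IsHermitian)
    (i : Fin a) : hA.eigenvalues i ≤ specNorm A := by
  have h := l2_opNorm_mulVec A (hA.eigenvectorBasis i)
  rw [hA.mulVec_eigenvectorBasis] at h
  have h2 : ‖WithLp.toLp 2 (hA.eigenvalues i • ⇑(hA.eigenvectorBasis i))‖ =
      ‖hA.eigenvalues i • hA.eigenvectorBasis i‖ := rfl
  rw [specNorm_eq]
  have h3 := hA.eigenvectorBasis.orthonormal.1 i
  have h4 : ‖hA.eigenvalues i • hA.eigenvectorBasis i‖ ≤ ‖A‖ * ‖hA.eigenvectorBasis i‖ := h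
  rw [norm_smul, h3, mul_one, mul_one] at h4
  exact (le_abs_self _).trans h4

/-- If `x = y + S y`, then positivity of `S` gives `‖y‖² ≤ Re ⟨y, x⟩ ≤ ‖y‖ ‖x‖`. -/
lemma norm_inv_one_add_le {a : ℕ} {S : Matrix (Fin a) (Fin a) ℂ} (hS : S.PosSemidef) :
    ‖(1 + S)⁻¹‖ ≤ 1 := by
  have hX : (1 + S).PosDef := PosDef.one.add_posSemidef hS
  have hXu : IsUnit (1 + S).det := (isUnit_iff_isUnit_det _).1 hX.isUnit
  rw [l2_opNorm_def]
  refine ContinuousLinearMap.opNorm_le_bound _ zero_le_one fun x => ?_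
  rw [one_mul]
  set y : EuclideanSpace ℂ (Fin a) := WithLp.toLp 2 ((1 + S)⁻¹ *ᵥ x.ofLp) with hy
  change ‖y‖ ≤ ‖x‖
  have hx : x = y + WithLp.toLp 2 (S *ᵥ y.ofLp) := by
    apply WithLp.ofLp_injective
    change x.ofLp = (1 + S)⁻¹ *ᵥ x.ofLp + S *ᵥ ((1 + S)⁻¹ *ᵥ x.ofLp)
    conv_rhs => enter [1]; rw [← one_mulVec ((1 + S)⁻¹ *ᵥ x.ofLp)]
    rw [← add_mulVec, mulVec_mulVec, mul_nonsing_inv _ hXu, one_mulVec]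
  have h1 : 0 ≤ RCLike.re (inner ℂ y (WithLp.toLp 2 (S *ᵥ y.ofLp))) := by
    rw [EuclideanSpace.inner_eq_star_dotProduct, dotProduct_comm]
    exact hS.re_dotProduct_nonneg y.ofLp
  have h2 : ‖y‖ ^ 2 ≤ ‖y‖ * ‖x‖ := by
    calc ‖y‖ ^ 2 ≤ RCLike.re (inner ℂ y x) := by
          conv_rhs => rw [hx]
          rw [inner_add_right, map_add, inner_self_eq_norm_sq]
          linarith
      _ ≤ ‖y‖ * ‖x‖ := re_inner_le_norm _ _
  rcases (norm_nonneg y).eq_or_lt with h | h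
  · rw [← h]; exact norm_nonneg _
  · nlinarith

lemma specNorm_rateGrad_le {K : ℕ} {n m : Fin K → ℕ}
    (H : ∀ k : Fin K, Matrix (Fin (n k)) (Fin (m k)) ℂ) (P : Profile m) (k : Fin K)
    (hP : (P k).PosSemidef) : specNorm (rateGrad H P k) ≤ specNorm (H k) ^ 2 := by
  simp only [specNorm_eq, rateGrad]
  have h1 := norm_inv_one_add_le (hP.mul_mul_conjTranspose_same (H k))
  calc ‖(H k)ᴴ * (1 + H k * P k * (H k)ᴴ)⁻¹ * H k‖
      ≤ ‖(H k)ᴴ * (1 + H k * P k * (H k)ᴴ)⁻¹‖ * ‖H k‖ := l2_opNorm_mul _ _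
    _ ≤ ‖(H k)ᴴ‖ * ‖(1 + H k * P k * (H k)ᴴ)⁻¹‖ * ‖H k‖ := by
        gcongr; exact l2_opNorm_mul _ _
    _ ≤ ‖(H k)ᴴ‖ * 1 * ‖H k‖ := by gcongr
    _ = ‖H k‖ ^ 2 := by rw [l2_opNorm_conjTranspose]; ring

end SpecNorm

/-! ### Regret of the policy. -/

section Policy

variable {K : ℕ} {n m : Fin K → ℕ}

lemma withPower_posSemidef {p : Fin K → ℝ} (hp : ∀ k, 0 ≤ p k) {Q : Profile m}
    (hQ : Q ∈ covSet m) (k : Fin K) : (withPower p Q k).PosSemidef :=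
  (hQ k).1.smul (hp k)

lemma withPower_mem_transmitSet {Pmax : Fin K → ℝ} {Ptot : ℝ} {p : Fin K → ℝ}
    (hp : p ∈ powerSet Pmax Ptot) {Q : Profile m} (hQ : Q ∈ covSet m) :
    withPower p Q ∈ transmitSet m Pmax Ptot := by
  have htr : ∀ k, (withPower p Q k).trace.re = p k := by
    intro k
    rw [withPower, Matrix.trace_smul, (hQ k).2, Complex.smul_re, Complex.one_re, smul_eq_mul,
      mul_one]
  refine ⟨fun k => ⟨withPower_posSemidef (fun k => (hp.1 k).1) hQ k, ?_⟩, ?_⟩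
  · rw [htr]; exact (hp.1 k).2
  · simp only [htr]; exact hp.2

lemma expMap_mem_covSet (hm : ∀ k, 1 ≤ m k) {Y : Profile m} (hY : ∀ k, (Y k).IsHermitian)
    (c : ℝ) : expMap c Y ∈ covSet m := by
  intro k
  have : Nonempty (Fin (m k)) := ⟨⟨0, hm k⟩⟩
  have h : (c • Y k).IsHermitian := by
    rw [Matrix.IsHermitian, Matrix.conjTranspose_smul, (hY k).eq]; simp
  exact ⟨posSemidef_gibbs h, trace_gibbs h⟩

lemma isHermitian_xlScore (hm : ∀ k, 1 ≤ m k) {p : Fin K → ℝ} (hp : ∀ k, 0 ≤ p k)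
    (H : ChannelStream n m) (η : ℝ) (t : ℕ) : ∀ k, (xlScore H p η t k).IsHermitian := by
  induction t with
  | zero => intro k; exact Matrix.isHermitian_zero
  | succ t ih =>
    intro k
    exact (ih k).add (((posSemidef_grad
      (withPower_posSemidef hp (expMap_mem_covSet hm ih _) k) _).smul (hp k)).1)

lemma xlCov_mem_covSet (hm : ∀ k, 1 ≤ m k) {p : Fin K → ℝ} (hp : ∀ k, 0 ≤ p k)
    (H : ChannelStream n m) (η : ℝ) (t : ℕ) : xlCov H p η t ∈ covSet m :=
  expMap_mem_covSet hm (isHermitian_xlScore hm hp H η _) _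

/-- First-order bound for the rate function. -/
lemma rate_sub_rate_le {p : Fin K → ℝ} (hp : ∀ k, 0 ≤ p k)
    (H : ∀ k : Fin K, Matrix (Fin (n k)) (Fin (m k)) ℂ) {Q Q₀ : Profile m}
    (hQ : Q ∈ covSet m) (hQ₀ : Q₀ ∈ covSet m) :
    rate H (withPower p Q₀) - rate H (withPower p Q) ≤
      ∑ k, p k * (rateGrad H (withPower p Q) k * (Q₀ k - Q k)).trace.re := by
  rw [rate, rate, ← Finset.sum_sub_distrib]
  refine Finset.sum_le_sum fun k _ => ?_
  refine (log_det_rate_sub_le (withPower_posSemidef hp hQ k)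
    (withPower_posSemidef hp hQ₀ k) (H k)).trans_eq ?_
  have : withPower p Q₀ k - withPower p Q k = p k • (Q₀ k - Q k) := (smul_sub _ _ _).symm
  rw [this, Matrix.mul_smul, Matrix.trace_smul, Complex.smul_re, smul_eq_mul, rateGrad]

lemma regret_xlCov_le (hm : ∀ k, 1 ≤ m k) {Pmax : Fin K → ℝ} {Ptot : ℝ} {p : Fin K → ℝ}
    (hp : p ∈ powerSet Pmax Ptot) {η : ℝ} (hη : 0 < η) (H : ChannelStream n m) {M : ℝ}
    (hM : ∀ t, 1 ≤ t → ∀ P ∈ transmitSet m Pmax Ptot, ∀ k, specNorm (rateGrad (H t) P k) ≤ M)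
    {Q₀ : Profile m} (hQ₀ : Q₀ ∈ covSet m) {T : ℕ} (hT : 1 ≤ T) :
    regret H p (xlCov H p η) Q₀ T ≤
      √(T : ℝ) * ((∑ k, Real.log (m k : ℝ)) / η + 4 * Ptot ^ 2 * M ^ 2 * η) := by
  have hp0 : ∀ k, 0 ≤ p k := fun k => (hp.1 k).1
  have hcov : ∀ t, xlCov H p η t ∈ covSet m := xlCov_mem_covSet hm hp0 H η
  have hlin : regret H p (xlCov H p η) Q₀ T ≤ ∑ k, ∑ t ∈ Finset.range T,
      p k * (rateGrad (H (t + 1)) (withPower p (xlCov H p η (t + 1))) k *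
        (Q₀ k - xlCov H p η (t + 1) k)).trace.re := by
    rw [Finset.sum_comm, regret, ← Finset.Ico_add_one_right_eq_Icc, Finset.sum_Ico_eq_sum_range,
      Nat.add_sub_cancel]
    refine Finset.sum_le_sum fun t _ => ?_
    rw [add_comm 1 t]
    exact rate_sub_rate_le hp0 _ (hcov _) hQ₀
  have hblock : ∀ k, ∑ t ∈ Finset.range T,
      p k * (rateGrad (H (t + 1)) (withPower p (xlCov H p η (t + 1))) k *
        (Q₀ k - xlCov H p η (t + 1) k)).trace.re ≤
      √(T : ℝ) * (Real.log (m k : ℝ) / η + 3 * (p k * M) ^ 2 * η) := by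
    intro k
    have : Nonempty (Fin (m k)) := ⟨⟨0, hm k⟩⟩
    have hV : ∀ t, (rateGrad (H (t + 1)) (withPower p (xlCov H p η (t + 1))) k).PosSemidef :=
      fun t => posSemidef_grad (withPower_posSemidef hp0 (hcov _) k) _
    -- Indices shift by one: stage `t + 1` plays the Gibbs state of the score `Y(t)` and then
    -- receives the payoff. The score recursion holds definitionally.
    have h := sum_trace_sub_gibbs_le (Y := fun t => xlScore H p η t k) hη (hp0 k) hV
      (β := M) (fun t i => (eigenvalues_le_specNorm (hV t).1 i).trans
        (hM _ (Nat.le_add_left 1 t) _ (withPower_mem_transmitSet hp (hcov _)) k))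
      rfl (fun t => rfl) (hQ₀ k).1 (hQ₀ k).2 hT
    rw [Fintype.card_fin] at h
    exact h
  -- The block errors add up to `3 M² η ∑ p_k²`; nonnegativity of the powers turns this into a
  -- multiple of `Ptot ^ 2`, and 3 is relaxed to 4.
  have hsq : ∑ k, p k ^ 2 ≤ Ptot ^ 2 := by
    rw [← hp.2]
    exact Finset.sum_sq_le_sq_sum_of_nonneg fun k _ => hp0 k
  refine hlin.trans ((Finset.sum_le_sum fun k _ => hblock k).trans ?_)
  rw [← Finset.mul_sum, Finset.sum_add_distrib, ← Finset.sum_div]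
  refine mul_le_mul_of_nonneg_left (add_le_add_right ?_ _) (Real.sqrt_nonneg _)
  calc ∑ k, 3 * (p k * M) ^ 2 * η = (3 * M ^ 2 * η) * ∑ k, p k ^ 2 := by
        rw [Finset.mul_sum]; exact Finset.sum_congr rfl fun k _ => by ring
    _ ≤ (3 * M ^ 2 * η) * Ptot ^ 2 := mul_le_mul_of_nonneg_left hsq (by positivity)
    _ ≤ 4 * Ptot ^ 2 * M ^ 2 * η := by
        have : 0 ≤ Ptot ^ 2 * M ^ 2 * η := by positivity
        linarith

lemma average_regret_xlCov_le (hm : ∀ k, 1 ≤ m k) {Pmax : Fin K → ℝ} {Ptot : ℝ} {p : Fin K → ℝ}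
    (hp : p ∈ powerSet Pmax Ptot) {η : ℝ} (hη : 0 < η) (H : ChannelStream n m) {M : ℝ}
    (hM : ∀ t, 1 ≤ t → ∀ P ∈ transmitSet m Pmax Ptot, ∀ k, specNorm (rateGrad (H t) P k) ≤ M)
    {Q₀ : Profile m} (hQ₀ : Q₀ ∈ covSet m) {T : ℕ} (hT : 1 ≤ T) :
    (1 / (T : ℝ)) * regret H p (xlCov H p η) Q₀ T ≤
      (1 / √(T : ℝ)) * ((∑ k, Real.log (m k : ℝ)) / η + 4 * Ptot ^ 2 * M ^ 2 * η) := by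
  have hT0 : (0 : ℝ) < T := by exact_mod_cast hT
  have h := mul_le_mul_of_nonneg_left (regret_xlCov_le hm hp hη H hM hQ₀ hT)
    (one_div_nonneg.2 hT0.le)
  refine h.trans_eq ?_
  rw [← mul_assoc]
  congr 1
  have h0 : 0 < √(T : ℝ) := Real.sqrt_pos.2 hT0
  rw [div_mul_eq_mul_div, one_mul, div_eq_div_iff hT0.ne' h0.ne', one_mul,
    Real.mul_self_sqrt hT0.le]

/-- Bounded channels supply the finite gradient bound that turns the explicit estimate into the
no-regret statement. -/
lemma exists_specNorm_rateGrad_le {Pmax : Fin K → ℝ} {Ptot : ℝ} {H : ChannelStream n m}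
    (hH : ∃ B : ℝ, ∀ t, 1 ≤ t → ∀ k, specNorm (H t k) ≤ B) :
    ∃ M : ℝ, ∀ t, 1 ≤ t → ∀ P ∈ transmitSet m Pmax Ptot, ∀ k,
      specNorm (rateGrad (H t) P k) ≤ M := by
  obtain ⟨B, hB⟩ := hH
  exact ⟨B ^ 2, fun t ht P hP k => (specNorm_rateGrad_le (H t) P k (hP.1 k).1).trans
    (pow_le_pow_left₀ (norm_nonneg _) (hB t ht k) 2)⟩

end Policy

lemma limsup_coe_le_zero_of_le_const_div_sqrt {u : ℕ → ℝ} {C : ℝ}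
    (hu : ∀ T : ℕ, 1 ≤ T → u T ≤ (1 / √(T : ℝ)) * C) :
    Filter.limsup (fun T : ℕ => ((u T : ℝ) : EReal)) Filter.atTop ≤ 0 := by
  have hlim : Filter.Tendsto (fun T : ℕ => (((1 / √(T : ℝ)) * C : ℝ) : EReal)) Filter.atTop
      (nhds ((0 : ℝ) : EReal)) := by
    refine (continuous_coe_real_ereal.tendsto 0).comp ?_
    have h1 : Filter.Tendsto (fun T : ℕ => √(T : ℝ)) Filter.atTop Filter.atTop :=
      Real.tendsto_sqrt_atTop.comp tendsto_natCast_atTop_atTop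
    simpa using (h1.inv_tendsto_atTop).mul_const C
  rw [← EReal.coe_zero, ← hlim.limsup_eq]
  refine Filter.limsup_le_limsup ?_
  filter_upwards [Filter.eventually_ge_atTop 1] with T hT
  exact EReal.coe_le_coe_iff.2 (hu T hT)

end OnlineMIMO

theorem proposition3 {K : ℕ} (n m : Fin K → ℕ) (hm : ∀ k, 1 ≤ m k)
    (Pmax : Fin K → ℝ) (Ptot : ℝ)
    (p : Fin K → ℝ) (hp : p ∈ OnlineMIMO.powerSet Pmax Ptot)
    (η : ℝ) (hη : 0 < η)
    (H : OnlineMIMO.ChannelStream n m)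
    (hH : ∃ B : ℝ, ∀ t, 1 ≤ t → ∀ k, OnlineMIMO.specNorm (H t k) ≤ B) :
    -- the policy always plays admissible covariance profiles
    (∀ t, 1 ≤ t → OnlineMIMO.xlCov H p η t ∈ OnlineMIMO.covSet m) ∧
    -- no regret
    (∀ Q₀ ∈ OnlineMIMO.covSet m,
      Filter.limsup
        (fun T : ℕ =>
          (((1 / (T : ℝ)) *
            OnlineMIMO.regret H p (OnlineMIMO.xlCov H p η) Q₀ T : ℝ) : EReal))
        Filter.atTop ≤ 0) ∧
    -- the explicit bound
    (∀ M : ℝ,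
      (∀ t, 1 ≤ t → ∀ P ∈ OnlineMIMO.transmitSet m Pmax Ptot, ∀ k,
        OnlineMIMO.specNorm (OnlineMIMO.rateGrad (H t) P k) ≤ M) →
      ∀ Q₀ ∈ OnlineMIMO.covSet m, ∀ T : ℕ, 1 ≤ T →
        (1 / (T : ℝ)) * OnlineMIMO.regret H p (OnlineMIMO.xlCov H p η) Q₀ T ≤
          (1 / √(T : ℝ)) *
            ((∑ k, Real.log (m k : ℝ)) / η + 4 * Ptot ^ 2 * M ^ 2 * η)) := by
  have hp0 : ∀ k, 0 ≤ p k := fun k => (hp.1 k).1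
  refine ⟨fun t _ => OnlineMIMO.xlCov_mem_covSet hm hp0 H η t, fun Q₀ hQ₀ => ?_,
    fun M hM Q₀ hQ₀ T hT => OnlineMIMO.average_regret_xlCov_le hm hp hη H hM hQ₀ hT⟩
  obtain ⟨M, hM⟩ := OnlineMIMO.exists_specNorm_rateGrad_le (Pmax := Pmax) (Ptot := Ptot) hH
  exact OnlineMIMO.limsup_coe_le_zero_of_le_const_div_sqrt fun T hT =>
    OnlineMIMO.average_regret_xlCov_le hm hp hη H hM hQ₀ hT
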